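/- Let $\mathcal G$ be a (small) groupoid and $\mathcal K=\{K_A\}_{A\in\mathrm{Obj}(\mathcal G)}$ a family of groups indexed by its objects. Definitions. $\mathrm{Aut}(\mathcal K)$ is the 2-groupoid with one object for each $A\in\mathrm{Obj}(\mathcal G)$, standing for the group $K_A$, whose 1-cells $A\to B$ are the group isomorphisms $K_A\to K_B$, and whose 2-cells $f\Rightarrow g$ between $f,g:K_A\to K_B$ are the elements $a\in K_B$ with $g(u)\,a=a\,f(u)$ for all $u\in K_A$; vertical composition is $b\circ a=ba$, and the horizontal composite of $a:f\Rightarrow f'$ with $b:g\Rightarrow g'$ is $b\,g(a):gf\Rightarrow g'f'$. Lax 2-functors $(F,\sigma)$ are normal: $F(1)=1$, with 2-cells $\sigma_{g,f}:F(gf)\Rightarrow F(g)F(f)$ that satisfy the coherence conditions with associativity and with identities (so $\sigma_{1,f}$ and $\sigma_{f,1}$ are identities). A weak action of $\mathcal G$ on $\mathcal K$ is a lax 2-functor $F:\mathcal G\to\mathrm{Aut}(\mathcal K)$ with $F(A)=K_A$ for every object $A$; a map of weak actions $F_1\to F_2$ is a lax 2-natural transformation $(\alpha,\tau)$, with 2-cells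 $\tau_f:\alpha_B F_1(f)\Rightarrow F_2(f)\alpha_A$ for $f:A\to B$, such that $\alpha_A=1_{K_A}$ for every object $A$. The cohomology $H^2_{|\mathrm{Aut}(\mathcal K)|}(\mathcal G,\mathcal K)$ is the set of connected components of the category of weak actions of $\mathcal G$ on $\mathcal K$. The geometric nerve $\mathrm N(\mathcal B)$ of a 2-category $\mathcal B$ is the simplicial set whose $n$-simplices are the lax 2-functors $[n]\to\mathcal B$; $\mathrm N(\mathcal G)$ is the usual nerve. Consider the simplicial maps $\mathrm N(\mathcal G)\to\mathrm N(\mathrm{Aut}(\mathcal K))$ that take each vertex $A$ to $K_A$. A homotopy $\mathrm N(\mathcal G)\times\Delta[1]\to\mathrm N(\mathrm{Aut}(\mathcal K))$ between two of them is normalized if it takes $\{A\}\times\Delta[1]$ to an identity arrow (a degenerate 1-simplex) for every object $A$. Write $\mathrm{SSet}_*[\mathrm N(\mathcal G),\mathrm N(\mathrm{Aut}(\mathcal K))]$ for the set of normalized homotopy classes of these simplicial maps. Theorem. The existence of a normalized homotopy is an equivalence relation on the simplicial maps $\mathrm N(\mathcal G)\to\mathrm N(\mathrm{Aut}(\mathcal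 K))$ that take each vertex $A$ to $K_A$, and there is a bijection $$H^2_{|\mathrm{Aut}(\mathcal K)|}(\mathcal G,\mathcal K)\;\cong\;\mathrm{SSet}_*\big[\mathrm N(\mathcal G),\mathrm N(\mathrm{Aut}(\mathcal K))\big],$$ which takes the class of a weak action $F$ to the class of the simplicial map $\mathrm N(F)$, $x\mapsto F\circ x$. -/

import Mathlib

universe u v w u₁ v₁ u₂ v₂

set_option linter.unusedSimpArgs false

namespace GroupoidCohomology

open CategoryTheory Bicategory Simplicial Opposite

/-! ### Normal lax 2-functors from a category to a 2-category

A 2-category is a strict bicategory: its associators and unitors are identities. (Strictness is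
not needed to write the axioms, so it is not assumed here.) A category is regarded as a 2-category with only identity
2-cells, so on such a domain the functors between hom categories are plain functions and the
naturality of the structural 2-cells is vacuous. Composition is written in diagrammatic order. -/

section Lax

variable {C : Type u₁} [Category.{v₁} C] {B : Type u} [Bicategory.{w, v} B]

/-- A (normal) lax 2-functor from a category `C` to a 2-category `B` whose function on objects
is `obj`. The structural 2-cell `F (f ≫ g) ⟶ F f ≫ F g` is indexed by `f`, `g`, the composite
`h` and a proof of `f ≫ g = h`, which is the same datum as a 2-cell for every pair `(f, g)`. -/
structure NormalLaxOn (obj : C → B) where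
  map {X Y : C} (f : X ⟶ Y) : obj X ⟶ obj Y
  σ {X Y Z : C} (f : X ⟶ Y) (g : Y ⟶ Z) (h : X ⟶ Z) (e : f ≫ g = h) : map h ⟶ map f ≫ map g
  /-- normalization -/
  map_id (X : C) : map (𝟙 X) = 𝟙 (obj X)
  /-- coherence with the associative law -/
  assoc {X Y Z T : C} (f : X ⟶ Y) (g : Y ⟶ Z) (h : Z ⟶ T) (fg : X ⟶ Z) (gh : Y ⟶ T)
    (fgh : X ⟶ T) (e₁ : f ≫ g = fg) (e₂ : g ≫ h = gh) (e₃ : fg ≫ h = fgh)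
    (e₄ : f ≫ gh = fgh) :
    σ fg h fgh e₃ ≫ (σ f g fg e₁ ▷ map h) ≫ (α_ (map f) (map g) (map h)).hom =
      σ f gh fgh e₄ ≫ (map f ◁ σ g h gh e₂)
  /-- coherence with the identity law -/
  id_left {X Y : C} (f : X ⟶ Y) :
    σ (𝟙 X) f f (Category.id_comp f) ≫ (eqToHom (map_id X) ▷ map f) ≫ (λ_ (map f)).hom =
      𝟙 (map f)
  /-- coherence with the identity law -/
  id_right {X Y : C} (f : X ⟶ Y) :
    σ f (𝟙 Y) f (Category.comp_id f) ≫ (map f ◁ eqToHom (map_id Y)) ≫ (ρ_ (map f)).hom =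
      𝟙 (map f)

/-- A lax 2-natural transformation between lax 2-functors. -/
structure LaxTrans {φ₁ φ₂ : C → B} (F₁ : NormalLaxOn φ₁) (F₂ : NormalLaxOn φ₂) where
  app (X : C) : φ₁ X ⟶ φ₂ X
  τ {X Y : C} (f : X ⟶ Y) : F₁.map f ≫ app Y ⟶ app X ≫ F₂.map f
  /-- normalization -/
  τ_id (X : C) :
    τ (𝟙 X) ≫ (app X ◁ eqToHom (F₂.map_id X)) ≫ (ρ_ (app X)).hom =
      (eqToHom (F₁.map_id X) ▷ app X) ≫ (λ_ (app X)).hom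
  /-- coherence -/
  τ_comp {X Y Z : C} (f : X ⟶ Y) (g : Y ⟶ Z) :
    (F₁.σ f g _ rfl ▷ app Z) ≫ (α_ (F₁.map f) (F₁.map g) (app Z)).hom ≫ (F₁.map f ◁ τ g) ≫
        (α_ (F₁.map f) (app Y) (F₂.map g)).inv ≫ (τ f ▷ F₂.map g) ≫
        (α_ (app X) (F₂.map f) (F₂.map g)).hom =
      τ (f ≫ g) ≫ (app X ◁ F₂.σ f g _ rfl)

/-- Precomposition of a lax 2-functor with a functor between categories. -/
def NormalLaxOn.precomp {D : Type u₂} [Category.{v₂} D] {φ : C → B} (F : NormalLaxOn φ)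
    (x : D ⥤ C) : NormalLaxOn (fun d => φ (x.obj d)) where
  map f := F.map (x.map f)
  σ f g h e := F.σ (x.map f) (x.map g) (x.map h) (by rw [← e, x.map_comp])
  map_id X := by rw [x.map_id, F.map_id]
  assoc f g h fg gh fgh e₁ e₂ e₃ e₄ := F.assoc _ _ _ _ _ _ _ _ _ _
  id_left {X Y} f := by
    have key : ∀ (i : x.obj X ⟶ x.obj X) (_ : i = 𝟙 _) (e : i ≫ x.map f = x.map f)
        (q : F.map i = 𝟙 _),
        F.σ i (x.map f) (x.map f) e ≫ (eqToHom q ▷ F.map (x.map f)) ≫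
          (λ_ (F.map (x.map f))).hom = 𝟙 (F.map (x.map f)) := by
      rintro _ rfl e q
      exact F.id_left _
    exact key _ (x.map_id X) _ _
  id_right {X Y} f := by
    have key : ∀ (i : x.obj Y ⟶ x.obj Y) (_ : i = 𝟙 _) (e : x.map f ≫ i = x.map f)
        (q : F.map i = 𝟙 _),
        F.σ (x.map f) i (x.map f) e ≫ (F.map (x.map f) ◁ eqToHom q) ≫
          (ρ_ (F.map (x.map f))).hom = 𝟙 (F.map (x.map f)) := by
      rintro _ rfl e q
      exact F.id_right _
    exact key _ (x.map_id Y) _ _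

variable (C B) in
/-- A (normal) lax 2-functor from a category `C` to a 2-category `B`. -/
structure NormalLax where
  obj : C → B
  on : NormalLaxOn obj

/-- Precomposition of a lax 2-functor with a functor between categories. -/
def NormalLax.precomp {D : Type u₂} [Category.{v₂} D] (F : NormalLax C B) (x : D ⥤ C) :
    NormalLax D B :=
  ⟨fun d => F.obj (x.obj d), F.on.precomp x⟩

variable (B) in
/-- The geometric nerve of a 2-category: its `n`-simplices are the normal lax 2-functors
from the ordinal `[n]`. -/
def geometricNerve : SSet.{max u v w} where
  obj n := NormalLax (Fin (n.unop.len + 1)) B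
  map f := ↾fun x => x.precomp (SimplexCategory.toCat.map f.unop).toFunctor
  map_id _ := rfl
  map_comp _ _ := rfl

end Lax

/-! ### The 2-groupoid of a family of groups -/

section Aut

/-- The objects of the 2-groupoid `Aut(K)` of a family of groups `K`: the indices, where `⟨x⟩`
stands for the group `K x`. -/
structure AutObj {X : Type u} (K : X → Type v) where
  idx : X

variable {X : Type u} {K : X → Type v} [∀ x, Group (K x)]

/-- A 2-cell `f ⟶ g` between group homomorphisms (here isomorphisms) from `K x` to `K y`: an
element `a` of `K y` with `g u * a = a * f u` for all `u`. -/
@[ext]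
structure AutCell {x y : X} (f g : K x ≃* K y) where
  elem : K y
  comm : ∀ u, g u * elem = elem * f u

instance : CategoryStruct (AutObj K) where
  Hom x y := K x.idx ≃* K y.idx
  id x := MulEquiv.refl (K x.idx)
  comp f g := MulEquiv.trans f g

instance (x y : AutObj K) : Category (x ⟶ y) where
  Hom f g := AutCell (x := x.idx) (y := y.idx) f g
  id f := ⟨1, fun u => by simp⟩
  comp {f g h} a b := ⟨b.elem * a.elem, fun u => by
    rw [← mul_assoc, b.comm, mul_assoc, a.comm, mul_assoc]⟩
  id_comp a := AutCell.ext (mul_one _)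
  comp_id a := AutCell.ext (one_mul _)
  assoc a b c := AutCell.ext (mul_assoc _ _ _).symm

/-- The element underlying a 2-cell of `Aut(K)`. -/
def elem {x y : AutObj K} {f g : x ⟶ y} (a : f ⟶ g) : K y.idx := AutCell.elem a

/-- The action on elements of a 1-cell of `Aut(K)`. -/
def act {x y : AutObj K} (f : x ⟶ y) : K x.idx ≃* K y.idx := f

theorem cell_comm {x y : AutObj K} {f g : x ⟶ y} (a : f ⟶ g) (u : K x.idx) :
    act g u * elem a = elem a * act f u := AutCell.comm a u

theorem cell_ext {x y : AutObj K} {f g : x ⟶ y} {a b : f ⟶ g} (h : elem a = elem b) : a = b :=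
  AutCell.ext h

/-- Left whiskering in `Aut(K)`: the 2-cell `b * id f`. -/
def whiskL {x y z : AutObj K} (f : x ⟶ y) {g g' : y ⟶ z} (b : g ⟶ g') : f ≫ g ⟶ f ≫ g' :=
  AutCell.mk (elem b) fun u => cell_comm b (act f u)

/-- Right whiskering in `Aut(K)`: the 2-cell `id g * a`. -/
def whiskR {x y z : AutObj K} {f f' : x ⟶ y} (a : f ⟶ f') (g : y ⟶ z) : f ≫ g ⟶ f' ≫ g :=
  AutCell.mk (act g (elem a)) fun u => by
    have := congrArg (act g) (cell_comm a u)
    rw [map_mul, map_mul] at this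
    exact this

/-- The invertible 2-cell with element `1` between two 1-cells with the same action. -/
def unitIso {x y : AutObj K} (f g : x ⟶ y) (h : ∀ u, act f u = act g u) : f ≅ g where
  hom := AutCell.mk 1 fun u => by rw [mul_one, one_mul]; exact (h u).symm
  inv := AutCell.mk 1 fun u => by rw [mul_one, one_mul]; exact h u
  hom_inv_id := cell_ext (one_mul 1)
  inv_hom_id := cell_ext (one_mul 1)

/-- `Aut(K)`, the full 2-subcategory, on the groups of the family `K`, of the 2-category of
groups and group isomorphisms: 1-cells are group isomorphisms, and the horizontal composite of
2-cells given by `a : f ⟶ f'` and `b : g ⟶ g'` is the element `b * g a`. -/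
instance : Bicategory (AutObj K) where
  homCategory := inferInstance
  whiskerLeft f _ _ b := whiskL f b
  whiskerRight a g := whiskR a g
  associator _ _ _ := unitIso _ _ fun _ => rfl
  leftUnitor _ := unitIso _ _ fun _ => rfl
  rightUnitor _ := unitIso _ _ fun _ => rfl
  whiskerLeft_id f g := rfl
  whiskerLeft_comp f g h i a b := rfl
  id_whiskerLeft a := by
    apply cell_ext
    exact ((mul_one _).trans (one_mul _)).symm
  comp_whiskerLeft f g h h' a := by
    apply cell_ext
    exact ((mul_one _).trans (one_mul _)).symm
  id_whiskerRight f g := by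
    apply cell_ext
    exact map_one (act g)
  comp_whiskerRight a b i := by
    apply cell_ext
    exact map_mul (act i) (elem b) (elem a)
  whiskerRight_id a := by
    apply cell_ext
    exact ((mul_one _).trans (one_mul _)).symm
  whiskerRight_comp a g h := by
    apply cell_ext
    exact ((mul_one _).trans (one_mul _)).symm
  whisker_assoc f g g' a h := by
    apply cell_ext
    exact ((mul_one _).trans (one_mul _)).symm
  whisker_exchange a b := by
    apply cell_ext
    exact cell_comm b (elem a)
  pentagon f g h i := by
    apply cell_ext
    change (1 * 1 * act i 1 : K _) = 1 * 1
    rw [map_one, mul_one]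
  triangle f g := by
    apply cell_ext
    change (1 * 1 : K _) = act g 1
    rw [map_one, one_mul]

theorem elem_eqToHom {x y : AutObj K} {f g : x ⟶ y} (h : f = g) : elem (eqToHom h) = 1 := by
  cases h; rfl

theorem autObj_strict : Bicategory.Strict (AutObj K) where
  id_comp _ := rfl
  comp_id _ := rfl
  assoc _ _ _ := rfl
  leftUnitor_eqToIso _ := Iso.ext (cell_ext (elem_eqToHom rfl).symm)
  rightUnitor_eqToIso _ := Iso.ext (cell_ext (elem_eqToHom rfl).symm)
  associator_eqToIso _ _ _ := Iso.ext (cell_ext (elem_eqToHom rfl).symm)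

/-! The elements underlying the 2-cells obtained from the operations of `Aut(K)`. -/

section Elem

variable {x y z t : AutObj K}

theorem elem_comp {f g h : x ⟶ y} (a : f ⟶ g) (b : g ⟶ h) : elem (a ≫ b) = elem b * elem a :=
  rfl

theorem elem_id (f : x ⟶ y) : elem (𝟙 f) = 1 := rfl

theorem elem_whiskerLeft (f : x ⟶ y) {g g' : y ⟶ z} (b : g ⟶ g') : elem (f ◁ b) = elem b := rfl

theorem elem_whiskerRight {f f' : x ⟶ y} (a : f ⟶ f') (g : y ⟶ z) :
    elem (a ▷ g) = act g (elem a) := rfl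

theorem elem_associator_hom (f : x ⟶ y) (g : y ⟶ z) (h : z ⟶ t) : elem (α_ f g h).hom = 1 := rfl

theorem elem_associator_inv (f : x ⟶ y) (g : y ⟶ z) (h : z ⟶ t) : elem (α_ f g h).inv = 1 := rfl

theorem elem_leftUnitor_hom (f : x ⟶ y) : elem (λ_ f).hom = 1 := rfl

theorem elem_leftUnitor_inv (f : x ⟶ y) : elem (λ_ f).inv = 1 := rfl

theorem elem_rightUnitor_hom (f : x ⟶ y) : elem (ρ_ f).hom = 1 := rfl

theorem act_comp (f : x ⟶ y) (g : y ⟶ z) (u : K x.idx) : act (f ≫ g) u = act g (act f u) := rfl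

theorem act_id (u : K x.idx) : act (𝟙 x) u = u := rfl

end Elem

end Aut

/-! ### Weak actions and cohomology -/

section Cohomology

variable (G : Type u) [Groupoid.{v} G] (K : G → Type w) [∀ A, Group (K A)]

/-- A weak action of the groupoid `G` on the family of groups `K`: a lax 2-functor from `G` to
`Aut(K)` which sends each object `A` to `K A`. -/
abbrev WeakAction : Type (max u v w) :=
  NormalLaxOn (fun A : G => (⟨A⟩ : AutObj K))

variable {G K}

/-- A map of weak actions: a lax 2-natural transformation whose 1-cell component at every object
is the identity. -/
def WeakAction.Hom (F₁ F₂ : WeakAction G K) : Type (max u v w) :=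
  { t : LaxTrans F₁ F₂ // ∀ A, t.app A = 𝟙 _ }

theorem WeakAction.Hom.ext {F₁ F₂ : WeakAction G K} (s t : WeakAction.Hom F₁ F₂)
    (h : ∀ {A B : G} (f : A ⟶ B), elem (s.1.τ f) = elem (t.1.τ f)) : s = t := by
  obtain ⟨⟨a, σ, h₁, h₂⟩, ha⟩ := s
  obtain ⟨⟨b, τ, h₃, h₄⟩, hb⟩ := t
  obtain rfl : a = fun _ => 𝟙 _ := funext ha
  obtain rfl : b = fun _ => 𝟙 _ := funext hb
  have : @σ = @τ := by
    funext A B f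
    exact cell_ext (h f)
  subst this
  rfl

theorem WeakAction.Hom.act_app {F₁ F₂ : WeakAction G K} (t : WeakAction.Hom F₁ F₂) (A : G)
    (k : K A) : act (t.1.app A) k = k := by
  rw [t.2]; rfl

/-- The identity lax 2-natural transformation. -/
def WeakAction.Hom.id (F : WeakAction G K) : WeakAction.Hom F F :=
  ⟨{ app := fun A => 𝟙 _
     τ := fun {A B} f => (ρ_ (F.map f)).hom ≫ (λ_ (F.map f)).inv
     τ_id := fun A => cell_ext (by
      simp only [elem_comp, elem_id, elem_whiskerLeft, elem_whiskerRight, elem_associator_hom,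
      elem_associator_inv, elem_leftUnitor_hom, elem_rightUnitor_hom, elem_eqToHom, act_comp,
      act_id, map_one, one_mul, mul_one, elem_leftUnitor_inv])
     τ_comp := fun {A B C} f g => cell_ext (by
      simp only [elem_comp, elem_id, elem_whiskerLeft, elem_whiskerRight, elem_associator_hom,
      elem_associator_inv, elem_leftUnitor_hom, elem_rightUnitor_hom, elem_eqToHom, act_comp,
      act_id, map_one, one_mul, mul_one, elem_leftUnitor_inv]) }, fun _ => rfl⟩

theorem WeakAction.Hom.elem_id (F : WeakAction G K) {A B : G} (f : A ⟶ B) :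
    elem ((WeakAction.Hom.id F).1.τ f) = 1 := one_mul (1 : K B)

/-- The normalization axiom of a map of weak actions, on elements. -/
theorem WeakAction.Hom.normalization {F₁ F₂ : WeakAction G K} (t : WeakAction.Hom F₁ F₂) (A : G) :
    elem (t.1.τ (𝟙 A)) = 1 := by
  have h := congrArg elem (t.1.τ_id A)
  simpa only [elem_comp, elem_id, elem_whiskerLeft, elem_whiskerRight, elem_associator_hom,
      elem_associator_inv, elem_leftUnitor_hom, elem_rightUnitor_hom, elem_eqToHom, act_comp,
      act_id, map_one, one_mul, mul_one] using h

/-- The coherence axiom of a map of weak actions, on elements. -/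
theorem WeakAction.Hom.coherence {F₁ F₂ : WeakAction G K} (t : WeakAction.Hom F₁ F₂)
    {A B C : G} (f : A ⟶ B) (g : B ⟶ C) :
    act (F₂.map g) (elem (t.1.τ f)) * elem (t.1.τ g) *
        elem (F₁.σ f g _ rfl) =
      elem (F₂.σ f g _ rfl) * elem (t.1.τ (f ≫ g)) := by
  have h := congrArg elem (t.1.τ_comp f g)
  simp only [elem_comp, elem_id, elem_whiskerLeft, elem_whiskerRight, elem_associator_hom,
      elem_associator_inv, elem_leftUnitor_hom, elem_rightUnitor_hom, elem_eqToHom, act_comp,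
      act_id, map_one, one_mul, mul_one, t.act_app] at h
  exact h

/-- The composite of two maps of weak actions, given by the composition
`(τ₂ f * α A) (β B * τ₁ f)` of lax 2-natural transformations. -/
def WeakAction.Hom.comp {F₁ F₂ F₃ : WeakAction G K} (s : WeakAction.Hom F₁ F₂)
    (t : WeakAction.Hom F₂ F₃) : WeakAction.Hom F₁ F₃ :=
  ⟨{ app := fun A => s.1.app A ≫ t.1.app A
     τ := fun {A B} f =>
      (α_ (F₁.map f) (s.1.app B) (t.1.app B)).inv ≫ (s.1.τ f ▷ t.1.app B) ≫
        (α_ (s.1.app A) (F₂.map f) (t.1.app B)).hom ≫ (s.1.app A ◁ t.1.τ f) ≫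
        (α_ (s.1.app A) (t.1.app A) (F₃.map f)).inv
     τ_id := fun A => cell_ext (by
      have h₁ := WeakAction.Hom.normalization s A
      have h₂ := WeakAction.Hom.normalization t A
      simp only [elem_comp, elem_id, elem_whiskerLeft, elem_whiskerRight, elem_associator_hom,
      elem_associator_inv, elem_leftUnitor_hom, elem_rightUnitor_hom, elem_eqToHom, act_comp,
      act_id, map_one, one_mul, mul_one, h₁, h₂])
     τ_comp := fun {A B C} f g => cell_ext (by
      have h₁ := WeakAction.Hom.coherence s f g
      have h₂ := WeakAction.Hom.coherence t f g
      have h₃ := cell_comm (t.1.τ g) (elem (s.1.τ f))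
      simp only [elem_comp, elem_id, elem_whiskerLeft, elem_whiskerRight, elem_associator_hom,
      elem_associator_inv, elem_leftUnitor_hom, elem_rightUnitor_hom, elem_eqToHom, act_comp,
      act_id, map_one, one_mul, mul_one, WeakAction.Hom.act_app] at h₁ h₂ h₃ ⊢
      calc _ = act (F₃.map g) (elem (t.1.τ f)) *
              (act (F₃.map g) (elem (s.1.τ f)) * elem (t.1.τ g)) *
              elem (s.1.τ g) * elem (F₁.σ f g _ rfl) := by
            simp only [map_mul, mul_assoc]
        _ = act (F₃.map g) (elem (t.1.τ f)) * elem (t.1.τ g) *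
              (act (F₂.map g) (elem (s.1.τ f)) *
              elem (s.1.τ g) * elem (F₁.σ f g _ rfl)) := by
            rw [h₃]; simp only [mul_assoc]
        _ = _ := by rw [h₁, ← mul_assoc, h₂, mul_assoc]) },
    fun A => by
      change s.1.app A ≫ t.1.app A = 𝟙 _
      rw [s.2, t.2]; rfl⟩

/-- The element underlying a component of a composite map of weak actions. -/
theorem WeakAction.Hom.elem_comp {F₁ F₂ F₃ : WeakAction G K} (s : WeakAction.Hom F₁ F₂)
    (t : WeakAction.Hom F₂ F₃) {A B : G} (f : A ⟶ B) :
    elem ((s.comp t).1.τ f) = elem (t.1.τ f) * elem (s.1.τ f) := by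
  change (1 * elem (t.1.τ f) * 1 * act (t.1.app B) (elem (s.1.τ f)) * 1 : K B) = _
  rw [WeakAction.Hom.act_app]
  simp only [one_mul, mul_one]

/-- The category of weak actions of `G` on `K`. -/
instance : Category (WeakAction G K) where
  Hom := WeakAction.Hom
  id := WeakAction.Hom.id
  comp := WeakAction.Hom.comp
  id_comp {F₁ F₂} t := WeakAction.Hom.ext _ _ fun f => by
    rw [WeakAction.Hom.elem_comp, WeakAction.Hom.elem_id, mul_one]
  comp_id {F₁ F₂} t := WeakAction.Hom.ext _ _ fun f => by
    rw [WeakAction.Hom.elem_comp, WeakAction.Hom.elem_id, one_mul]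
  assoc s t r := WeakAction.Hom.ext _ _ fun f => by
    simp only [WeakAction.Hom.elem_comp, mul_assoc]

variable (G K) in
/-- The 2-dimensional cohomology of `G` with coefficients in `Aut(K)`: the set of connected
components of the category of weak actions. -/
def H2 : Type (max u v w) := ConnectedComponents (WeakAction G K)

/-- The cohomology class of a weak action. -/
def WeakAction.cls (F : WeakAction G K) : H2 G K := Quotient.mk _ F

end Cohomology

/-! ### Normalized homotopy classes of simplicial maps -/

section Homotopy

/-- A homotopy of simplicial maps, given by `H.h : X ⊗ Δ[1] ⟶ Y`, is normalized if it takes every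
vertex of `X` to an identity arrow, that is, the 1-simplex of `Y` traced by each vertex of `X` is
the degenerate 1-simplex on a vertex of `Y`. -/
def IsNormalized {X Y : SSet.{u}} {f g : X ⟶ Y} (H : SSet.Homotopy f g) : Prop :=
  ∀ x : X _⦋0⦌, ∃ y : Y _⦋0⦌,
    H.h.app (op ⦋1⦌) (X.σ 0 x, SSet.stdSimplex.objEquiv.symm (𝟙 ⦋1⦌)) = Y.σ 0 y

variable (G : Type u) [Groupoid.{v} G] (K : G → Type v) [∀ A, Group (K A)]

/-- The simplicial maps from the nerve of `G` to the geometric nerve of `Aut(K)` which on vertices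
are the indexing of `K`, that is, which take each object `A` of `G` to `K A`. -/
def IndexedMap : Type (max u v) :=
  { f : nerve G ⟶ geometricNerve (AutObj K) //
    ∀ A : G, (f.app (op ⦋0⦌) (ComposableArrows.mk₀ A)).obj 0 = ⟨A⟩ }

variable {G K}

/-- There is a normalized homotopy from `f` to `g`. -/
def NormHomotopic (f g : IndexedMap G K) : Prop :=
  ∃ H : SSet.Homotopy f.1 g.1, IsNormalized H

variable (G K) in
/-- Normalized homotopy classes of simplicial maps: the quotient by the equivalence relation
generated by normalized homotopy. -/
def NormHomotopyClasses : Type (max u v) := Quot (NormHomotopic (G := G) (K := K))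

/-- The normalized homotopy class of a simplicial map. -/
def IndexedMap.cls (f : IndexedMap G K) : NormHomotopyClasses G K := Quot.mk _ f

/-- The simplicial map induced on nerves by a weak action, `x ↦ F ∘ x` on simplices. -/
def WeakAction.nerveMap (F : WeakAction G K) : IndexedMap G K :=
  ⟨{ app := fun _ => ↾fun x => ⟨_, NormalLaxOn.precomp F x⟩
     naturality := fun _ _ _ => rfl }, fun _ => rfl⟩

end Homotopy

end GroupoidCohomology

/-! Two correspondences reduce the theorem to the invertibility of maps of weak actions.

The geometric nerve is fully faithful on normal lax 2-functors. A lax functor on `[n]` is determined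
by its 1-cells on edges and its 2-cells on triangles. A simplicial map out of `nerve C` therefore
assigns a 1-cell to each arrow and a 2-cell to each composable pair; its 3-simplices give the
associativity law and its degenerate simplices the normalization. Hence simplicial maps with
prescribed vertices are exactly nerves of lax functors (`laxNerve_injective`,
`laxNerve_laxOfNerveMap`).

This holds for every category `C`, so it applies also to `G × [1]`, whose nerve is `nerve G ⊗ Δ[1]`.
A homotopy is thus a lax functor `W` on the cylinder `G × [1]`, and it is normalized when `W` is the
identity on the vertical arrows. The square over an arrow `f` consists of two triangles; the 2-cell
of one, times the inverse of that of the other, is the component at `f` of a map of weak actions.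
Conversely a map of weak actions fills the cylinder. So a normalized homotopy exists exactly when a
map of weak actions does (`normHomotopic_nerveMap_iff`).

Such maps compose and, their components being group elements, are invertible. Normalized homotopy is
therefore an equivalence relation, and a zigzag of maps collapses to a single map. -/

namespace GroupoidCohomology

open CategoryTheory Bicategory Simplicial Opposite

/-! ### Lax functors to `Aut(K)` as nonabelian cocycles of group elements -/

section LaxElem

variable {C : Type u₁} [Category.{v₁} C] {I : Type u} {K : I → Type v} [∀ i, Group (K i)]
  {φ : C → AutObj K}

namespace NormalLaxOn

/-- The element underlying a structural 2-cell of a lax 2-functor to `Aut(K)`. -/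
def sElem (F : NormalLaxOn φ) {X Y Z : C} (f : X ⟶ Y) (g : Y ⟶ Z) (h : X ⟶ Z)
    (e : f ≫ g = h) : K (φ Z).idx := elem (F.σ f g h e)

theorem sElem_comm (F : NormalLaxOn φ) {X Y Z : C} (f : X ⟶ Y) (g : Y ⟶ Z) (h : X ⟶ Z)
    (e : f ≫ g = h) (u : K (φ X).idx) :
    act (F.map g) (act (F.map f) u) * F.sElem f g h e = F.sElem f g h e * act (F.map h) u :=
  cell_comm (F.σ f g h e) u

theorem sElem_assoc (F : NormalLaxOn φ) {X Y Z T : C} (f : X ⟶ Y) (g : Y ⟶ Z) (h : Z ⟶ T)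
    (fg : X ⟶ Z) (gh : Y ⟶ T) (fgh : X ⟶ T) (e₁ : f ≫ g = fg) (e₂ : g ≫ h = gh)
    (e₃ : fg ≫ h = fgh) (e₄ : f ≫ gh = fgh) :
    act (F.map h) (F.sElem f g fg e₁) * F.sElem fg h fgh e₃ =
      F.sElem g h gh e₂ * F.sElem f gh fgh e₄ := by
  have h := congrArg elem (F.assoc f g h fg gh fgh e₁ e₂ e₃ e₄)
  simp only [elem_comp, elem_whiskerLeft, elem_whiskerRight, elem_associator_hom, one_mul] at h
  exact h

theorem sElem_id_left (F : NormalLaxOn φ) {X Y : C} (f : X ⟶ Y) (e : 𝟙 X ≫ f = f) :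
    F.sElem (𝟙 X) f f e = 1 := by
  have h := congrArg elem (F.id_left f)
  simp only [elem_comp, elem_id, elem_whiskerRight, elem_leftUnitor_hom, elem_eqToHom, map_one,
    one_mul] at h
  exact h

theorem sElem_id_right (F : NormalLaxOn φ) {X Y : C} (f : X ⟶ Y) (e : f ≫ 𝟙 Y = f) :
    F.sElem f (𝟙 Y) f e = 1 := by
  have h := congrArg elem (F.id_right f)
  simp only [elem_comp, elem_id, elem_whiskerLeft, elem_rightUnitor_hom, elem_eqToHom,
    one_mul] at h
  exact h

/-- A lax 2-functor to `Aut(K)` from the elements underlying its structural 2-cells. -/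
def ofElem (map : ∀ {X Y : C}, (X ⟶ Y) → (φ X ⟶ φ Y))
    (s : ∀ {X Y Z : C} (f : X ⟶ Y) (g : Y ⟶ Z) (h : X ⟶ Z), f ≫ g = h → K (φ Z).idx)
    (comm : ∀ {X Y Z : C} (f : X ⟶ Y) (g : Y ⟶ Z) (h : X ⟶ Z) (e : f ≫ g = h) u,
      act (map g) (act (map f) u) * s f g h e = s f g h e * act (map h) u)
    (map_id : ∀ X, map (𝟙 X) = 𝟙 (φ X))
    (assoc : ∀ {X Y Z T : C} (f : X ⟶ Y) (g : Y ⟶ Z) (h : Z ⟶ T)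
      (fg : X ⟶ Z) (gh : Y ⟶ T) (fgh : X ⟶ T) (e₁ : f ≫ g = fg) (e₂ : g ≫ h = gh)
      (e₃ : fg ≫ h = fgh) (e₄ : f ≫ gh = fgh),
      act (map h) (s f g fg e₁) * s fg h fgh e₃ = s g h gh e₂ * s f gh fgh e₄)
    (id_left : ∀ {X Y : C} (f : X ⟶ Y) (e : 𝟙 X ≫ f = f), s (𝟙 X) f f e = 1)
    (id_right : ∀ {X Y : C} (f : X ⟶ Y) (e : f ≫ 𝟙 Y = f), s f (𝟙 Y) f e = 1) :
    NormalLaxOn φ where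
  map := map
  σ f g h e := AutCell.mk (s f g h e) (comm f g h e)
  map_id := map_id
  assoc f g h fg gh fgh e₁ e₂ e₃ e₄ := cell_ext (by
    simp only [elem_comp, elem_whiskerLeft, elem_whiskerRight, elem_associator_hom, one_mul]
    exact assoc f g h fg gh fgh e₁ e₂ e₃ e₄)
  id_left f := cell_ext (by
    simp only [elem_comp, elem_id, elem_whiskerRight, elem_leftUnitor_hom, elem_eqToHom, map_one,
      one_mul]
    exact id_left f _)
  id_right f := cell_ext (by
    simp only [elem_comp, elem_id, elem_whiskerLeft, elem_rightUnitor_hom, elem_eqToHom, one_mul]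
    exact id_right f _)

theorem ext_elem {F F' : NormalLaxOn φ} (hmap : ∀ {X Y : C} (f : X ⟶ Y), F.map f = F'.map f)
    (hs : ∀ {X Y Z : C} (f : X ⟶ Y) (g : Y ⟶ Z) (h : X ⟶ Z) (e : f ≫ g = h),
      F.sElem f g h e = F'.sElem f g h e) : F = F' := by
  obtain ⟨m, σ, _, _, _, _⟩ := F
  obtain ⟨m', σ', _, _, _, _⟩ := F'
  obtain rfl : @m = @m' := by
    funext X Y f
    exact hmap f
  obtain rfl : @σ = @σ' := by
    funext X Y Z f g h e
    exact cell_ext (hs f g h e)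
  rfl

end NormalLaxOn

end LaxElem

/-! ### Fixing the function on objects -/

section LaxNerve

variable {C : Type u₁} [Category.{v₁} C]

theorem NormalLax.mk_injective {B : Type u} [Bicategory.{w, v} B] {φ : C → B}
    {F F' : NormalLaxOn φ} (h : NormalLax.mk φ F = NormalLax.mk φ F') : F = F' := by
  injection h

/-- The function on objects of a lax 2-functor can be replaced by a pointwise equal one. -/
theorem NormalLax.exists_mk_eq {B : Type u} [Bicategory.{w, v} B] (F : NormalLax C B) (φ : C → B)
    (h : ∀ c, F.obj c = φ c) : ∃ L : NormalLaxOn φ, F = ⟨φ, L⟩ := by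
  obtain ⟨ψ, L⟩ := F
  obtain rfl : ψ = φ := funext h
  exact ⟨L, rfl⟩

end LaxNerve

/-! ### Full faithfulness of the geometric nerve -/

section Nerve

variable {C : Type u} [Category.{v} C] {I : Type u} {K : I → Type v} [∀ i, Group (K i)]
  {φ : C → AutObj K}

/-- The simplicial map induced on nerves by a lax 2-functor, `x ↦ F ∘ x` on simplices. -/
def NormalLaxOn.laxNerve (F : NormalLaxOn φ) : nerve C ⟶ geometricNerve (AutObj K) where
  app _ := ↾fun x => ⟨_, F.precomp x⟩
  naturality _ _ _ := rfl

/-- The 1-cells are read off at the edges `.mk₁ f`, the 2-cells at the triangles `.mk₂ f g`. -/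
theorem NormalLaxOn.laxNerve_injective :
    Function.Injective (NormalLaxOn.laxNerve (φ := φ)) := by
  intro F F' h
  have key {n : ℕ} (x : ComposableArrows C n) : F.precomp x = F'.precomp x :=
    NormalLax.mk_injective (congrArg (fun t => t.app (op ⦋n⦌) x) h)
  apply NormalLaxOn.ext_elem
  · intro X Y f
    exact congrArg (fun L => L.map (X := (0 : Fin 2)) (Y := 1) (homOfLE (by simp)))
      (key (.mk₁ f))
  · rintro X Y Z f g _ rfl
    exact congrArg (fun L => L.sElem (X := (0 : Fin 3)) (Y := 1) (Z := 2) (homOfLE (by decide))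
      (homOfLE (by decide)) (homOfLE (by decide)) rfl) (key (.mk₂ f g))

/-- Naturality at the inclusion of the `i`-th vertex. -/
theorem app_obj_eq (f : nerve C ⟶ geometricNerve (AutObj K))
    (hf : ∀ c : C, (f.app (op ⦋0⦌) (ComposableArrows.mk₀ c)).obj 0 = φ c)
    {n : ℕ} (x : ComposableArrows C n) (i : Fin (n + 1)) :
    (f.app (op ⦋n⦌) x).obj i = φ (x.obj i) := by
  have h := ConcreteCategory.congr_hom (f.naturality (SimplexCategory.const ⦋0⦌ ⦋n⦌ i).op) x
  have e : (nerve C).map (SimplexCategory.const ⦋0⦌ ⦋n⦌ i).op x =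
      ComposableArrows.mk₀ (x.obj i) := ComposableArrows.ext₀ rfl
  have h' := congrArg (fun y : NormalLax (Fin 1) (AutObj K) => y.obj 0) h
  refine h'.symm.trans (Eq.trans ?_ (hf (x.obj i)))
  exact congrArg (fun y => (f.app (op ⦋0⦌) y).obj 0) e

/-- A simplex of the geometric nerve carries its own function on objects. Replacing it by `φ ∘
x.obj` lets 1-cells and 2-cells from different simplices be compared without transport. -/
theorem exists_simplexLax (f : nerve C ⟶ geometricNerve (AutObj K))
    (hf : ∀ c : C, (f.app (op ⦋0⦌) (ComposableArrows.mk₀ c)).obj 0 = φ c)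
    {n : ℕ} (x : ComposableArrows C n) :
    ∃ L : NormalLaxOn (fun i : Fin (n + 1) => φ (x.obj i)), f.app (op ⦋n⦌) x = ⟨_, L⟩ :=
  NormalLax.exists_mk_eq _ _ (app_obj_eq f hf x)

/-- The value of a simplicial map at a simplex of the nerve, with its function on objects
prescribed by the values at the vertices. -/
noncomputable def simplexLax (f : nerve C ⟶ geometricNerve (AutObj K))
    (hf : ∀ c : C, (f.app (op ⦋0⦌) (ComposableArrows.mk₀ c)).obj 0 = φ c)
    {n : ℕ} (x : ComposableArrows C n) : NormalLaxOn (fun i : Fin (n + 1) => φ (x.obj i)) :=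
  (exists_simplexLax f hf x).choose

section

variable (f : nerve C ⟶ geometricNerve (AutObj K))
  (hf : ∀ c : C, (f.app (op ⦋0⦌) (ComposableArrows.mk₀ c)).obj 0 = φ c)

theorem app_eq_simplexLax {n : ℕ} (x : ComposableArrows C n) :
    f.app (op ⦋n⦌) x = ⟨_, simplexLax f hf x⟩ := (exists_simplexLax f hf x).choose_spec

theorem simplexLax_map {m n : ℕ} (θ : ⦋m⦌ ⟶ ⦋n⦌) (x : ComposableArrows C n) :
    simplexLax f hf ((nerve C).map θ.op x) =
      (simplexLax f hf x).precomp (SimplexCategory.toCat.map θ).toFunctor := by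
  apply NormalLax.mk_injective
  refine (app_eq_simplexLax f hf ((nerve C).map θ.op x)).symm.trans ?_
  have h := ConcreteCategory.congr_hom (f.naturality θ.op) x
  refine h.trans ?_
  exact congrArg (fun y : NormalLax (Fin (n + 1)) (AutObj K) =>
    y.precomp (SimplexCategory.toCat.map θ).toFunctor) (app_eq_simplexLax f hf x)

/-- The 1-cell that a simplicial map assigns to an arrow. -/
noncomputable def edgeCell {A B : C} (a : A ⟶ B) : φ A ⟶ φ B :=
  (simplexLax f hf (.mk₁ a)).map (X := (0 : Fin 2)) (Y := 1) (homOfLE (by simp))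

/-- The element underlying the 2-cell that a simplicial map assigns to a composite of arrows. -/
noncomputable def triangleElem {A B D : C} (a : A ⟶ B) (b : B ⟶ D) : K (φ D).idx :=
  (simplexLax f hf (.mk₂ a b)).sElem (X := (0 : Fin 3)) (Y := 1) (Z := 2) (homOfLE (by decide))
    (homOfLE (by decide)) (homOfLE (by decide)) rfl

/-- Every arrow `i ⟶ j` of `[n]` is the image of `0 ⟶ 1` under an operator `[1] ⟶ [n]`, so
naturality reduces the claim to edges. The next lemma does the same for triangles. -/
theorem simplexLax_map_eq {n : ℕ} (x : ComposableArrows C n) {i j : Fin (n + 1)} (a : i ⟶ j) :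
    (simplexLax f hf x).map a = edgeCell f hf (x.map a) := by
  have key (y : ComposableArrows C 1) :
      (simplexLax f hf y).map (X := (0 : Fin 2)) (Y := 1) (homOfLE (by simp)) =
        edgeCell f hf (y.map (homOfLE (by simp))) := by
    obtain ⟨A, B, b, rfl⟩ := ComposableArrows.mk₁_surjective y
    rfl
  have h := key ((nerve C).map (SimplexCategory.mkOfLe i j (leOfHom a)).op x)
  rw [simplexLax_map] at h
  exact h

theorem simplexLax_sElem_eq {n : ℕ} (x : ComposableArrows C n) {i j k : Fin (n + 1)} (a : i ⟶ j)
    (b : j ⟶ k) (c : i ⟶ k) (e : a ≫ b = c) :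
    (simplexLax f hf x).sElem a b c e = triangleElem f hf (x.map a) (x.map b) := by
  have key (y : ComposableArrows C 2) :
      (simplexLax f hf y).sElem (X := (0 : Fin 3)) (Y := 1) (Z := 2) (homOfLE (by decide))
        (homOfLE (by decide)) (homOfLE (by decide)) rfl =
        triangleElem f hf (y.map (X := (0 : Fin 3)) (Y := 1) (homOfLE (by decide)))
          (y.map (X := (1 : Fin 3)) (Y := 2) (homOfLE (by decide))) := by
    obtain ⟨A, B, D, b, b', rfl⟩ := ComposableArrows.mk₂_surjective y
    rfl
  have h := key ((nerve C).map (SimplexCategory.mkOfLeComp i j k (leOfHom a) (leOfHom b)).op x)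
  rw [simplexLax_map] at h
  exact h

/-- The lax 2-functor whose nerve is a given simplicial map. -/
noncomputable def laxOfNerveMap : NormalLaxOn φ :=
  .ofElem (edgeCell f hf) (fun a b _ _ => triangleElem f hf a b)
    (by
      rintro A B D a b _ rfl u
      have h := (simplexLax f hf (.mk₂ a b)).sElem_comm (X := (0 : Fin 3)) (Y := 1) (Z := 2)
        (homOfLE (by decide)) (homOfLE (by decide)) (homOfLE (by decide)) rfl u
      rw [simplexLax_map_eq, simplexLax_map_eq, simplexLax_map_eq] at h
      exact h)
    (fun A => by
      -- The 0-simplex at `A` sees `𝟙 A` as the image of the identity of its vertex.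
      have h := (simplexLax f hf (.mk₀ A)).map_id 0
      rw [simplexLax_map_eq] at h
      exact h)
    (by
      rintro A B D E a b c _ _ _ rfl rfl rfl _
      -- The four faces of this 3-simplex carry the four 2-cells of the cocycle law.
      have h := (simplexLax f hf (.mk₃ a b c)).sElem_assoc (X := (0 : Fin 4)) (Y := 1) (Z := 2)
        (T := 3) (homOfLE (by decide)) (homOfLE (by decide)) (homOfLE (by decide))
        (homOfLE (by decide)) (homOfLE (by decide)) (homOfLE (by decide)) rfl rfl rfl rfl
      simp only [simplexLax_map_eq, simplexLax_sElem_eq] at h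
      exact h)
    (fun a e => by
      -- The triangle on `𝟙 A` and `a` is degenerate, so its 2-cell is already one of the edge `a`.
      have h := (simplexLax f hf (.mk₁ a)).sElem_id_left (X := (0 : Fin 2)) (Y := 1)
        (homOfLE (by decide)) rfl
      rw [simplexLax_sElem_eq] at h
      exact h)
    (fun a e => by
      have h := (simplexLax f hf (.mk₁ a)).sElem_id_right (X := (0 : Fin 2)) (Y := 1)
        (homOfLE (by decide)) rfl
      rw [simplexLax_sElem_eq] at h
      exact h)

theorem laxNerve_laxOfNerveMap : (laxOfNerveMap f hf).laxNerve = f := by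
  ext ⟨⟨n⟩⟩ x
  refine Eq.trans ?_ (app_eq_simplexLax f hf x).symm
  refine congrArg (NormalLax.mk _) (NormalLaxOn.ext_elem ?_ ?_)
  · intro i j a
    exact (simplexLax_map_eq f hf x a).symm
  · intro i j k a b c e
    exact (simplexLax_sElem_eq f hf x a b c e).symm

end

end Nerve

/-! ### Maps of weak actions as group elements, and their inverses -/

section Cell

variable {I : Type u} {K : I → Type v} [∀ i, Group (K i)] {x y : AutObj K}

/-- The 2-cell of `Aut(K)` with a given underlying element. -/
def mkCell {f g : x ⟶ y} (a : K y.idx) (h : ∀ u, act g u * a = a * act f u) : f ⟶ g :=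
  AutCell.mk a h

theorem elem_mkCell {f g : x ⟶ y} (a : K y.idx) (h : ∀ u, act g u * a = a * act f u) :
    elem (mkCell a h) = a := rfl

end Cell

section Groupoid

variable {G : Type u} [Groupoid.{v} G] {K : G → Type w} [∀ A, Group (K A)]
  {F₁ F₂ : WeakAction G K}

namespace WeakAction.Hom

/-- The element underlying a component of a map of weak actions. -/
def tElem (t : WeakAction.Hom F₁ F₂) {A B : G} (f : A ⟶ B) : K B := elem (t.1.τ f)

theorem tElem_comm (t : WeakAction.Hom F₁ F₂) {A B : G} (f : A ⟶ B) (k : K A) :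
    act (F₂.map f) k * t.tElem f = t.tElem f * act (F₁.map f) k := by
  have h := cell_comm (t.1.τ f) k
  rw [act_comp, act_comp, t.act_app, t.act_app] at h
  exact h

theorem tElem_id (t : WeakAction.Hom F₁ F₂) (A : G) : t.tElem (𝟙 A) = 1 := t.normalization A

theorem tElem_comp (t : WeakAction.Hom F₁ F₂) {A B C : G} (f : A ⟶ B) (g : B ⟶ C) (h : A ⟶ C)
    (e : f ≫ g = h) :
    act (F₂.map g) (t.tElem f) * t.tElem g * F₁.sElem f g h e =
      F₂.sElem f g h e * t.tElem h := by
  subst e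
  exact t.coherence f g

/-- A map of weak actions from the elements underlying its components. -/
def ofElem (t : ∀ {A B : G}, (A ⟶ B) → K B)
    (comm : ∀ {A B : G} (f : A ⟶ B) (k : K A), act (F₂.map f) k * t f = t f * act (F₁.map f) k)
    (t_id : ∀ A : G, t (𝟙 A) = 1)
    (t_comp : ∀ {A B C : G} (f : A ⟶ B) (g : B ⟶ C),
      act (F₂.map g) (t f) * t g * F₁.sElem f g _ rfl = F₂.sElem f g _ rfl * t (f ≫ g)) :
    WeakAction.Hom F₁ F₂ :=
  ⟨{ app := fun A => 𝟙 _
     τ := fun f => (ρ_ (F₁.map f)).hom ≫ mkCell (t f) (comm f) ≫ (λ_ (F₂.map f)).inv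
     τ_id := fun A => cell_ext (by
      simp only [elem_mkCell, GroupoidCohomology.elem_comp, elem_whiskerLeft, elem_whiskerRight, elem_rightUnitor_hom,
        elem_leftUnitor_hom, elem_leftUnitor_inv, elem_eqToHom, map_one, one_mul, mul_one]
      exact t_id A)
     τ_comp := fun f g => cell_ext (by
      simp only [elem_mkCell, GroupoidCohomology.elem_comp, elem_whiskerLeft, elem_whiskerRight, elem_associator_hom,
        elem_associator_inv, elem_rightUnitor_hom, elem_leftUnitor_inv, act_id, one_mul, mul_one]
      exact t_comp f g) }, fun _ => rfl⟩

/-- The inverse of a map of weak actions. -/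
def inv (t : WeakAction.Hom F₁ F₂) : WeakAction.Hom F₂ F₁ :=
  ofElem (fun f => (t.tElem f)⁻¹)
    (fun f k => by
      rw [eq_inv_mul_iff_mul_eq, ← mul_assoc, ← t.tElem_comm, mul_inv_cancel_right])
    (fun A => by rw [t.tElem_id, inv_one])
    (fun f g => by
      have h := t.tElem_comp f g _ rfl
      -- Inverting a product reverses it; this exchange puts the factors in the order that the
      -- inverse law needs.
      have hc := t.tElem_comm g (t.tElem f)
      rw [hc] at h
      rw [map_inv, ← mul_inv_rev, inv_mul_eq_iff_eq_mul, ← mul_assoc, h, mul_inv_cancel_right])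

end WeakAction.Hom

end Groupoid

/-! ### The cylinder `G × [1]` -/

section Cylinder

open MonoidalCategory

variable {G : Type u} [Groupoid.{v} G] {K : G → Type w} [∀ A, Group (K A)]

/-- The lax 2-functor on the product of `G` with the arrow category that corresponds to a map of
weak actions. -/
def WeakAction.Hom.cylinder {F₁ F₂ : WeakAction G K} (t : WeakAction.Hom F₁ F₂) :
    NormalLaxOn (fun p : G × Fin 2 => (⟨p.1⟩ : AutObj K)) :=
  -- An arrow from level 0 to level 1 over `a` gets the 1-cell `F₁ a`. The element of `t` is then
  -- needed only when the first arrow of the pair crosses the levels: there the source is `F₁` of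
  -- the composite and the target follows `F₁ a` by `F₂ b`.
  .ofElem (fun {p _} a => if p.2 = 0 then F₁.map a.1 else F₂.map a.1)
    (fun {p q _} a b c e =>
      if p.2 = 0 then
        (if q.2 = 0 then 1 else t.tElem b.1) * F₁.sElem a.1 b.1 c.1 (congrArg Prod.fst e)
      else F₂.sElem a.1 b.1 c.1 (congrArg Prod.fst e))
    (by
      rintro ⟨A, i⟩ ⟨B, j⟩ ⟨D, k⟩ a b c e u
      have hij : i ≤ j := leOfHom a.2
      have e' : a.1 ≫ b.1 = c.1 := congrArg Prod.fst e
      have h₁ := F₁.sElem_comm a.1 b.1 c.1 e' u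
      have h₂ := F₂.sElem_comm a.1 b.1 c.1 e' u
      have h₃ := t.tElem_comm b.1 (act (F₁.map a.1) u)
      fin_cases i <;> fin_cases j
      · change _ * (1 * _) = 1 * _ * _
        rw [one_mul]
        exact h₁
      · change act (F₂.map b.1) (act (F₁.map a.1) u) * (t.tElem b.1 * F₁.sElem a.1 b.1 c.1 e') =
          t.tElem b.1 * F₁.sElem a.1 b.1 c.1 e' * act (F₁.map c.1) u
        rw [← mul_assoc, h₃, mul_assoc, h₁, mul_assoc]
      · exact absurd hij (by decide)
      · exact h₂)
    (by
      rintro ⟨A, i⟩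
      by_cases hi : i = 0
      · simp [hi, F₁.map_id]
      · simp [hi, F₂.map_id])
    (by
      rintro ⟨A, i⟩ ⟨B, j⟩ ⟨D, k⟩ ⟨E, l⟩ a b c ab bc abc e₁ e₂ e₃ e₄
      have hij : i ≤ j := leOfHom a.2
      have hjk : j ≤ k := leOfHom b.2
      have e₁' : a.1 ≫ b.1 = ab.1 := congrArg Prod.fst e₁
      have e₂' : b.1 ≫ c.1 = bc.1 := congrArg Prod.fst e₂
      have e₃' : ab.1 ≫ c.1 = abc.1 := congrArg Prod.fst e₃
      have e₄' : a.1 ≫ bc.1 = abc.1 := congrArg Prod.fst e₄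
      have h₁ := F₁.sElem_assoc a.1 b.1 c.1 ab.1 bc.1 abc.1 e₁' e₂' e₃' e₄'
      have h₂ := F₂.sElem_assoc a.1 b.1 c.1 ab.1 bc.1 abc.1 e₁' e₂' e₃' e₄'
      have h₃ := t.tElem_comm c.1 (F₁.sElem a.1 b.1 ab.1 e₁')
      have h₄ := t.tElem_comp b.1 c.1 bc.1 e₂'
      -- The cases are the places where the chain of four objects passes from level 0 to level 1.
      -- The coherence of `t` enters only when the first arrow crosses; when the second does, the
      -- commutation rule `h₃` suffices.
      fin_cases i
      · fin_cases j
        · fin_cases k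
          · change act (F₁.map c.1) (1 * _) * (1 * _) = 1 * _ * (1 * _)
            simp only [one_mul]
            exact h₁
          · change act (F₂.map c.1) (1 * F₁.sElem a.1 b.1 ab.1 e₁') *
                (t.tElem c.1 * F₁.sElem ab.1 c.1 abc.1 e₃') =
              t.tElem c.1 * F₁.sElem b.1 c.1 bc.1 e₂' * (1 * F₁.sElem a.1 bc.1 abc.1 e₄')
            rw [one_mul, one_mul, ← mul_assoc, h₃, mul_assoc, h₁, mul_assoc]
        · fin_cases k
          · exact absurd hjk (by decide)
          · change act (F₂.map c.1) (t.tElem b.1 * F₁.sElem a.1 b.1 ab.1 e₁') *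
                (t.tElem c.1 * F₁.sElem ab.1 c.1 abc.1 e₃') =
              F₂.sElem b.1 c.1 bc.1 e₂' * (t.tElem bc.1 * F₁.sElem a.1 bc.1 abc.1 e₄')
            rw [map_mul, mul_assoc, ← mul_assoc (act _ (F₁.sElem a.1 b.1 ab.1 e₁')), h₃,
              mul_assoc, h₁, ← mul_assoc, ← mul_assoc, h₄, mul_assoc]
      · fin_cases j
        · exact absurd hij (by decide)
        · fin_cases k
          · exact absurd hjk (by decide)
          · exact h₂)
    (by
      rintro ⟨A, i⟩ ⟨B, j⟩ a e
      by_cases hi : i = 0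
      · simp [hi, F₁.sElem_id_left]
      · simp [hi, F₂.sElem_id_left])
    (by
      rintro ⟨A, i⟩ ⟨B, j⟩ a e
      by_cases hi : i = 0
      · simp [hi, F₁.sElem_id_right, t.tElem_id]
      · simp [hi, F₂.sElem_id_right])

/-- A functor to the product with the arrow category, as a simplex of the product with the
1-simplex. -/
def cylinderToProd : nerve (G × Fin 2) ⟶ nerve G ⊗ Δ[1] where
  app n := ↾fun (y : ComposableArrows (G × Fin 2) n.unop.len) =>
    (y ⋙ CategoryTheory.Prod.fst G (Fin 2), SSet.stdSimplex.objMk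
      ⟨fun i => (y.obj i).2, fun _ _ h => leOfHom (y.map (homOfLE h)).2⟩)
  naturality _ _ _ := rfl

/-- A simplex of the product with the 1-simplex, as a functor to the product with the arrow
category. -/
def prodToCylinder : nerve G ⊗ Δ[1] ⟶ nerve (G × Fin 2) where
  app n := ↾fun y => Functor.prod' (show ComposableArrows G n.unop.len from y.1)
    (SSet.stdSimplex.asOrderHom y.2).monotone.functor
  naturality _ _ _ := rfl

/-- The inclusion of an end of the cylinder. -/
def endInclusion (i : Fin 2) : nerve G ⟶ nerve (G × Fin 2) where
  app n := ↾fun (y : ComposableArrows G n.unop.len) => y ⋙ CategoryTheory.Prod.sectL G i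
  naturality _ _ _ := rfl

end Cylinder

/-! ### Normalized homotopies and maps of weak actions -/

section Homotopy

variable {G : Type u} [Groupoid.{v} G] {K : G → Type v} [∀ A, Group (K A)]
  {F₁ F₂ : WeakAction G K}

theorem endInclusion_laxNerve (W : NormalLaxOn (fun p : G × Fin 2 => (⟨p.1⟩ : AutObj K)))
    (i : Fin 2) :
    endInclusion i ≫ W.laxNerve = NormalLaxOn.laxNerve (W.precomp (CategoryTheory.Prod.sectL G i)) := rfl

/-- The homotopy that corresponds to a map of weak actions. -/
def WeakAction.Hom.homotopy (t : WeakAction.Hom F₁ F₂) :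
    SSet.Homotopy F₁.nerveMap.1 F₂.nerveMap.1 where
  h := prodToCylinder ≫ t.cylinder.laxNerve
  h₀ := by
    ext ⟨⟨n⟩⟩ x
    -- At level 0 the 2-cells of the cylinder carry a factor `1`, so this end agrees with `F₁` only
    -- up to `one_mul`.
    exact congrArg (NormalLax.mk (fun i : Fin (n + 1) =>
      (⟨(show ComposableArrows G n from x).obj i⟩ : AutObj K)))
      (NormalLaxOn.ext_elem (fun _ => rfl) (fun _ _ _ _ => one_mul _))
  h₁ := rfl
  -- The homotopy is relative to the empty subcomplex.
  rel := by
    ext n ⟨⟨x, hx⟩, y⟩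
    exact hx.elim

/-- Over a fixed object only `𝟙 A` occurs in the `G` coordinate, where `F₁`, `F₂` and `t` are all
normalized. -/
theorem WeakAction.Hom.homotopy_isNormalized (t : WeakAction.Hom F₁ F₂) :
    IsNormalized t.homotopy := by
  intro x
  obtain ⟨A, rfl⟩ : ∃ A : G, x = ComposableArrows.mk₀ A :=
    ⟨(show ComposableArrows G 0 from x).obj 0, ComposableArrows.ext₀ rfl⟩
  refine ⟨F₁.laxNerve.app (op ⦋0⦌) (.mk₀ A), ?_⟩
  refine congrArg (NormalLax.mk (fun _ : Fin 2 => (⟨A⟩ : AutObj K)))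
    (NormalLaxOn.ext_elem ?_ ?_)
  · intro i j a
    change (if i = 0 then F₁.map (𝟙 A) else F₂.map (𝟙 A)) = F₁.map (𝟙 A)
    rw [F₁.map_id, F₂.map_id, ite_self]
  · intro i j k a b c e
    have key (x y : K A) (hx : x = 1) (hy : y = 1) :
        (if i = 0 then (if j = 0 then 1 else t.tElem (𝟙 A)) * x else y) = x := by
      rw [t.tElem_id, ite_self, one_mul, hx, hy, ite_self]
    exact key _ _ (F₁.sElem_id_left (𝟙 A) (Category.comp_id _))
      (F₂.sElem_id_left (𝟙 A) (Category.comp_id _))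

/-- A lax 2-functor on the cylinder which is the identity on the vertical arrows gives a map of
weak actions between its restrictions to the ends. -/
def WeakAction.Hom.ofCylinder (W : NormalLaxOn (fun p : G × Fin 2 => (⟨p.1⟩ : AutObj K)))
    (hW : ∀ A : G, W.map (X := (A, 0)) (Y := (A, 1)) (𝟙 A, homOfLE (Fin.zero_le _)) = 𝟙 _) :
    WeakAction.Hom (W.precomp (CategoryTheory.Prod.sectL G 0))
      (W.precomp (CategoryTheory.Prod.sectL G 1)) :=
  let v (A : G) : (A, (0 : Fin 2)) ⟶ (A, 1) := (𝟙 A, homOfLE (Fin.zero_le _))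
  let e {A B : G} (i : Fin 2) (f : A ⟶ B) : (A, i) ⟶ (B, i) := (f, 𝟙 i)
  let d {A B : G} (f : A ⟶ B) : (A, (0 : Fin 2)) ⟶ (B, 1) := (f, homOfLE (Fin.zero_le _))
  have hv (A : G) (u : K A) : act (W.map (v A)) u = u := by rw [hW]; rfl
  have ev {A B : G} (f : A ⟶ B) : e 0 f ≫ v B = d f := Prod.ext (Category.comp_id f) rfl
  have ve {A B : G} (f : A ⟶ B) : v A ≫ e 1 f = d f := Prod.ext (Category.id_comp f) rfl
  have ed {A B C : G} (f : A ⟶ B) (g : B ⟶ C) : e 0 f ≫ d g = d (f ≫ g) := rfl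
  have de {A B C : G} (f : A ⟶ B) (g : B ⟶ C) : d f ≫ e 1 g = d (f ≫ g) := rfl
  have ee {A B C : G} (i : Fin 2) (f : A ⟶ B) (g : B ⟶ C) : e i f ≫ e i g = e i (f ≫ g) := rfl
  -- The two triangles of the square over `f` share the diagonal `d f`; as `W` is the identity on
  -- vertical arrows, their 2-cells run from `W (d f)` to the 1-cells on `e 1 f` and on `e 0 f`.
  ofElem (fun f => W.sElem (v _) (e 1 f) (d f) (ve f) * (W.sElem (e 0 f) (v _) (d f) (ev f))⁻¹)
    (fun {A B} f k => by
      have h₀ := W.sElem_comm (e 0 f) (v B) (d f) (ev f) k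
      have h₁ := W.sElem_comm (v A) (e 1 f) (d f) (ve f) k
      rw [hv] at h₀ h₁
      change act (W.map (e 1 f)) k * _ = _ * act (W.map (e 0 f)) k
      rw [← mul_assoc, h₁, mul_assoc, mul_assoc]
      congr 1
      rw [eq_inv_mul_iff_mul_eq, ← mul_assoc, ← h₀, mul_inv_cancel_right])
    (fun A => by
      have h₀ := W.sElem_id_left (v A) (ev (𝟙 A))
      have h₁ := W.sElem_id_right (v A) (ve (𝟙 A))
      exact (congrArg₂ (fun a b => a * b⁻¹) h₁ h₀).trans (by simp))
    (fun {A B C} f g => by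
      -- These are the cocycle laws of the three tetrahedra that triangulate the prism over `f`,
      -- `g`; the 2-cells of its inner triangles cancel.
      have h₀ := W.sElem_assoc (e 0 f) (e 0 g) (v C) _ _ _ (ee 0 f g) (ev g) (ev (f ≫ g)) (ed f g)
      have h₁ := W.sElem_assoc (e 0 f) (v B) (e 1 g) _ _ _ (ev f) (ve g) (de f g) (ed f g)
      have h₂ := W.sElem_assoc (v A) (e 1 f) (e 1 g) _ _ _ (ve f) (ee 1 f g) (de f g) (ve (f ≫ g))
      rw [hv] at h₀
      change act (W.map (e 1 g)) _ * _ * W.sElem (e 0 f) (e 0 g) (e 0 (f ≫ g)) (ee 0 f g) =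
        W.sElem (e 1 f) (e 1 g) (e 1 (f ≫ g)) (ee 1 f g) * _
      rw [← mul_assoc (W.sElem (e 1 f) (e 1 g) (e 1 (f ≫ g)) (ee 1 f g)), ← h₂,
        eq_mul_inv_iff_mul_eq, mul_assoc, h₀, ← mul_assoc, mul_assoc (act _ _),
        inv_mul_cancel_right, map_mul, mul_assoc, mul_assoc, ← h₁, map_inv, inv_mul_cancel_left])

/-- A normalized homotopy gives a map of weak actions. -/
theorem WeakAction.nonempty_hom_of_homotopy (H : SSet.Homotopy F₁.nerveMap.1 F₂.nerveMap.1)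
    (hH : IsNormalized H) : Nonempty (WeakAction.Hom F₁ F₂) := by
  have key₀ : endInclusion 0 ≫ cylinderToProd ≫ H.h = F₁.laxNerve := H.h₀
  have key₁ : endInclusion 1 ≫ cylinderToProd ≫ H.h = F₂.laxNerve := H.h₁
  -- Every vertex of the cylinder lies on one of the two ends, where the homotopy is known.
  have hvert (p : G × Fin 2) : ((cylinderToProd ≫ H.h).app (op ⦋0⦌)
      (ComposableArrows.mk₀ p)).obj 0 = (⟨p.1⟩ : AutObj K) := by
    obtain ⟨A, i⟩ := p
    have e : (ComposableArrows.mk₀ (A, i) : ComposableArrows (G × Fin 2) 0) =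
      ComposableArrows.mk₀ A ⋙ CategoryTheory.Prod.sectL G i := ComposableArrows.ext₀ rfl
    rw [e]
    fin_cases i
    · exact congrArg (fun t => (t.app (op ⦋0⦌) (ComposableArrows.mk₀ A)).obj 0) key₀
    · exact congrArg (fun t => (t.app (op ⦋0⦌) (ComposableArrows.mk₀ A)).obj 0) key₁
  have hW := laxNerve_laxOfNerveMap (cylinderToProd ≫ H.h) hvert
  generalize laxOfNerveMap (cylinderToProd ≫ H.h) hvert = W at hW
  have e₀ : W.precomp (CategoryTheory.Prod.sectL G 0) = F₁ :=
    NormalLaxOn.laxNerve_injective <|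
      (endInclusion_laxNerve W 0).symm.trans ((congrArg (endInclusion 0 ≫ ·) hW).trans key₀)
  have e₁ : W.precomp (CategoryTheory.Prod.sectL G 1) = F₂ :=
    NormalLaxOn.laxNerve_injective <|
      (endInclusion_laxNerve W 1).symm.trans ((congrArg (endInclusion 1 ≫ ·) hW).trans key₁)
  rw [← e₀, ← e₁]
  refine ⟨WeakAction.Hom.ofCylinder W fun A => ?_⟩
  obtain ⟨y, hy⟩ := hH (ComposableArrows.mk₀ A)
  have hy' : NormalLax.mk (fun _ : Fin 2 => (⟨A⟩ : AutObj K))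
      (W.precomp (CategoryTheory.Prod.sectR A (Fin 2))) = (geometricNerve (AutObj K)).σ 0 y :=
    (congrArg (fun t => t.app (op ⦋1⦌) (CategoryTheory.Prod.sectR A (Fin 2))) hW).trans hy
  -- The vertex `y` given by normalization lies over `A`, so the degenerate edge on it has the
  -- 1-cell `L.map (𝟙 0)`, an identity.
  have hobj (i : Fin 1) : y.obj i = (⟨A⟩ : AutObj K) := by
    obtain rfl := Subsingleton.elim i 0
    exact (congrArg (fun z : NormalLax (Fin 2) (AutObj K) => z.obj 0) hy').symm
  obtain ⟨L, rfl⟩ := NormalLax.exists_mk_eq y _ hobj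
  have h := congrArg (fun L => L.map (X := (0 : Fin 2)) (Y := 1) (homOfLE (Fin.zero_le _)))
    (NormalLax.mk_injective hy')
  exact h.trans (L.map_id 0)

end Homotopy

/-! ### Passage to classes -/

section Classes

variable {G : Type u} [Groupoid.{v} G] {K : G → Type v} [∀ A, Group (K A)]

theorem normHomotopic_nerveMap_iff (F₁ F₂ : WeakAction G K) :
    NormHomotopic F₁.nerveMap F₂.nerveMap ↔ Nonempty (WeakAction.Hom F₁ F₂) :=
  ⟨fun ⟨H, hH⟩ => WeakAction.nonempty_hom_of_homotopy H hH,
    fun ⟨t⟩ => ⟨t.homotopy, t.homotopy_isNormalized⟩⟩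

theorem WeakAction.nerveMap_surjective :
    Function.Surjective (WeakAction.nerveMap (G := G) (K := K)) := fun f =>
  ⟨laxOfNerveMap f.1 f.2, Subtype.ext (laxNerve_laxOfNerveMap f.1 f.2)⟩

theorem normHomotopic_equivalence : Equivalence (NormHomotopic (G := G) (K := K)) where
  refl f := by
    obtain ⟨F, rfl⟩ := WeakAction.nerveMap_surjective f
    exact (normHomotopic_nerveMap_iff F F).2 ⟨WeakAction.Hom.id F⟩
  symm {f g} h := by
    obtain ⟨F₁, rfl⟩ := WeakAction.nerveMap_surjective f
    obtain ⟨F₂, rfl⟩ := WeakAction.nerveMap_surjective g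
    obtain ⟨t⟩ := (normHomotopic_nerveMap_iff F₁ F₂).1 h
    exact (normHomotopic_nerveMap_iff F₂ F₁).2 ⟨t.inv⟩
  trans {f g k} h h' := by
    obtain ⟨F₁, rfl⟩ := WeakAction.nerveMap_surjective f
    obtain ⟨F₂, rfl⟩ := WeakAction.nerveMap_surjective g
    obtain ⟨F₃, rfl⟩ := WeakAction.nerveMap_surjective k
    obtain ⟨s⟩ := (normHomotopic_nerveMap_iff F₁ F₂).1 h
    obtain ⟨t⟩ := (normHomotopic_nerveMap_iff F₂ F₃).1 h'
    exact (normHomotopic_nerveMap_iff F₁ F₃).2 ⟨s.comp t⟩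

/-- Each step of a zigzag is a normalized homotopy in one direction or the other, and these can be
reversed and composed. -/
theorem WeakAction.zigzag_iff (F₁ F₂ : WeakAction G K) :
    Zigzag F₁ F₂ ↔ NormHomotopic F₁.nerveMap F₂.nerveMap := by
  constructor
  · intro h
    induction h with
    | refl => exact normHomotopic_equivalence.refl _
    | tail _ h ih =>
      refine normHomotopic_equivalence.trans ih ?_
      rcases h with h | h
      · exact (normHomotopic_nerveMap_iff _ _).2 h
      · exact normHomotopic_equivalence.symm ((normHomotopic_nerveMap_iff _ _).2 h)
  · intro h
    obtain ⟨t⟩ := (normHomotopic_nerveMap_iff F₁ F₂).1 h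
    exact Zigzag.of_hom t

/-- The map that takes the class of a weak action to the class of its nerve. -/
def nerveClass : H2 G K → NormHomotopyClasses G K :=
  Quotient.lift (fun F : WeakAction G K => F.nerveMap.cls) fun F₁ F₂ h =>
    Quot.sound ((WeakAction.zigzag_iff F₁ F₂).1 h)

theorem nerveClass_bijective : Function.Bijective (nerveClass (G := G) (K := K)) := by
  constructor
  · rintro ⟨F₁⟩ ⟨F₂⟩ h
    -- Equality in the `Quot` only gives the generated equivalence, which is the relation itself by
    -- `normHomotopic_equivalence`.
    exact Quotient.sound ((WeakAction.zigzag_iff F₁ F₂).2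
      ((normHomotopic_equivalence.eqvGen_iff).1 (Quot.eqvGen_exact h)))
  · rintro ⟨f⟩
    obtain ⟨F, rfl⟩ := WeakAction.nerveMap_surjective f
    exact ⟨F.cls, rfl⟩

end Classes

end GroupoidCohomology

theorem theorem4p1 (G : Type u) [CategoryTheory.Groupoid.{v} G] (K : G → Type v)
    [∀ A, Group (K A)] :
    Equivalence (GroupoidCohomology.NormHomotopic (G := G) (K := K)) ∧
      ∃ e : GroupoidCohomology.H2 G K ≃ GroupoidCohomology.NormHomotopyClasses G K,
        ∀ F : GroupoidCohomology.WeakAction G K, e F.cls = F.nerveMap.cls :=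
  ⟨GroupoidCohomology.normHomotopic_equivalence,
    Equiv.ofBijective _ GroupoidCohomology.nerveClass_bijective, fun _ => rfl⟩
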